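/- All graphs are finite and simple. For a graph $G$, let $\omega(G)$ be its clique number, $\chi(G)$ its chromatic number, and $G^2$ its square, i.e. the graph obtained from $G$ by adding an edge between any two distinct vertices that are joined by a two-edge path in $G$. A graph is claw-free if it has no induced subgraph isomorphic to $K_{1,3}$. For a positive integer $d$, let $\chi'_s(d)$ be the supremum of $\chi(L(F)^2)$ over all graphs $F$ of maximum degree $d$, where $L(F)$ denotes the line graph of $F$. Theorem. Fix an integer $\omega \ge 5$. Then every claw-free graph $G$ with $\omega(G)=\omega$ satisfies $$\chi(G^2) \le \max\{\chi'_s(\omega),\ 2\omega(\omega-1)-3\}.$$ -/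

import Mathlib

/-- The square of a graph: two distinct vertices are adjacent if they are adjacent in `G` or are
joined by a two-edge path in `G`. -/
def SimpleGraph.square {V : Type*} (G : SimpleGraph V) : SimpleGraph V :=
  SimpleGraph.mk (fun u v => u ≠ v ∧ (G.Adj u v ∨ ∃ w, G.Adj u w ∧ G.Adj w v))
    ⟨fun _ _ h => ⟨h.1.symm, h.2.imp (fun a => a.symm)
      (fun ⟨w, a, b⟩ => ⟨w, b.symm, a.symm⟩)⟩⟩
    ⟨fun _ h => h.1 rfl⟩

/-- A graph is claw-free if it has no induced subgraph isomorphic to the complete bipartite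
graph `K_{1,3}`. -/
def SimpleGraph.ClawFree {V : Type*} (G : SimpleGraph V) : Prop :=
  ¬ (completeBipartiteGraph (Fin 1) (Fin 3)).IsIndContained G

open Classical in
/-- The supremum of `χ(L²)` over the line graphs `L` of all finite simple graphs `F` of maximum
degree `d`. Every finite graph is isomorphic to one on some `Fin n`. The supremum is taken
in `ℕ∞`. -/
noncomputable def strongChromaticSup (d : ℕ) : ℕ∞ :=
  ⨆ (n : ℕ) (F : SimpleGraph (Fin n)) (_ : F.maxDegree = d), F.lineGraph.square.chromaticNumber

/-! ### Claws and clustered neighbourhoods -/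

namespace SimpleGraph

variable {V : Type*} {G : SimpleGraph V}

/-! Write ω for the clique number and call `v` clustered if N(v) is a disjoint union of cliques.

If `v` is not clustered, N(v) contains an induced path, whose middle vertex is redundant for
reaching the second neighbourhood. This saving, with a double count when deg(v) is large, puts the
degree of `v` in the square below 2ω(ω-1)-3 (`ClawFree.degree_square_lt`). Such vertices, and
isolated ones, can be coloured greedily last (`Colorable.of_induce`).

The other vertices behave like edges of a graph. The maximal cliques through an edge at a clustered
vertex cover each vertex at most twice (`ClawFree.eq_or_eq_or_eq`). Taking them as nodes gives a
root graph of maximum degree at most ω, in which each clustered non-isolated vertex is an edge.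
Adjacency in the square passes to the square of its line graph, even through an unclustered middle
vertex, so χ'_s(ω) colours suffice. -/

theorem ClawFree.adj_or_adj_or_adj (h : G.ClawFree) {u x y z : V} (hx : G.Adj u x)
    (hy : G.Adj u y) (hz : G.Adj u z) (hxy : x ≠ y) (hxz : x ≠ z) (hyz : y ≠ z) :
    G.Adj x y ∨ G.Adj x z ∨ G.Adj y z := by
  by_contra! hn
  obtain ⟨h1, h2, h3⟩ := hn
  have h1' := fun e : G.Adj y x => h1 e.symm
  have h2' := fun e : G.Adj z x => h2 e.symm
  have h3' := fun e : G.Adj z y => h3 e.symm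
  refine h ⟨⟨⟨Sum.elim (fun _ => u) ![x, y, z], ?_⟩, ?_⟩⟩
  · rintro (a | a) (b | b) hab
    · exact congrArg _ (Subsingleton.elim a b)
    · exfalso; fin_cases b <;> simp at hab <;> subst hab <;> simp_all
    · exfalso; fin_cases a <;> simp at hab <;> subst hab <;> simp_all
    · fin_cases a <;> fin_cases b <;> simp_all
  · intro a b
    change G.Adj (Sum.elim (fun _ => u) ![x, y, z] a) (Sum.elim (fun _ => u) ![x, y, z] b) ↔ _
    rcases a with a | a <;> rcases b with b | b
    · simp
    · fin_cases b <;> simp_all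
    · fin_cases a <;> simp_all [G.adj_comm]
    · fin_cases a <;> fin_cases b <;> simp_all

/-- The neighbourhood of `v` induces a disjoint union of cliques. -/
def IsClusterNeighborhood (G : SimpleGraph V) (v : V) : Prop :=
  ∀ ⦃x y z⦄, G.Adj v x → G.Adj v y → G.Adj v z → G.Adj x y → G.Adj y z → x ≠ z → G.Adj x z

/-! ### Degrees in the square at unclustered vertices -/

section Degree

open Classical in
/-- The vertices at distance exactly two from `v`. -/
noncomputable def secondNeighborFinset [Fintype V] (G : SimpleGraph V) (v : V) : Finset V :=
  {x | x ≠ v ∧ ¬ G.Adj v x ∧ ∃ u, G.Adj v u ∧ G.Adj u x}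

open Classical in
/-- The neighbours of `u` outside the closed neighbourhood of `v`. -/
noncomputable def outerNeighborFinset [Fintype V] (G : SimpleGraph V) (v u : V) : Finset V :=
  {x | x ≠ v ∧ ¬ G.Adj v x ∧ G.Adj u x}

theorem card_lt_cliqueNum_of_forall_adj [Finite V] {s : Finset V} (hs : G.IsClique s) {v : V}
    (hv : ∀ x ∈ s, G.Adj v x) : s.card < G.cliqueNum := by
  classical
  have hvs : v ∉ s := fun h => G.irrefl (hv v h)
  have : G.IsClique ((insert v s : Finset V) : Set V) := by
    rw [Finset.coe_insert]
    exact hs.insert fun b hb _ => hv b hb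
  have := this.card_le_cliqueNum
  rw [Finset.card_insert_of_notMem hvs] at this
  omega

variable [Fintype V] {v : V}

theorem ClawFree.card_outerNeighborFinset_lt (h : G.ClawFree) {u : V} (hu : G.Adj v u) :
    (G.outerNeighborFinset v u).card < G.cliqueNum := by
  refine card_lt_cliqueNum_of_forall_adj (v := u) ?_ (by simp +contextual [outerNeighborFinset])
  intro x hx y hy hxy
  simp only [outerNeighborFinset, Finset.coe_filter, Finset.mem_univ, true_and, Set.mem_ofPred_eq]
    at hx hy
  rcases h.adj_or_adj_or_adj hu.symm hx.2.2 hy.2.2 hx.1.symm hy.1.symm hxy with h | h | h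
  · exact absurd h hx.2.1
  · exact absurd h hy.2.1
  · exact h

open Classical in
theorem degree_square_le (G : SimpleGraph V) (v : V) :
    G.square.degree v ≤ G.degree v + (G.secondNeighborFinset v).card := by
  rw [← card_neighborFinset_eq_degree, ← card_neighborFinset_eq_degree]
  refine (Finset.card_le_card ?_).trans (Finset.card_union_le _ _)
  intro x hx
  rw [mem_neighborFinset] at hx
  obtain ⟨hne, hx⟩ := hx
  simp only [secondNeighborFinset, Finset.mem_union, mem_neighborFinset, Finset.mem_filter,
    Finset.mem_univ, true_and]
  by_cases hvx : G.Adj v x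
  · exact Or.inl hvx
  · exact Or.inr ⟨hne.symm, hvx, hx.resolve_left hvx⟩

open Classical in
theorem ClawFree.card_secondNeighborFinset_le (h : G.ClawFree)
    (hv : ¬ G.IsClusterNeighborhood v) :
    (G.secondNeighborFinset v).card ≤ (G.degree v - 1) * (G.cliqueNum - 1) := by
  unfold IsClusterNeighborhood at hv
  push Not at hv
  obtain ⟨x, y, z, hx, hy, hz, hxy, hyz, hne, hxz⟩ := hv
  have hsub : G.secondNeighborFinset v ⊆
      ((G.neighborFinset v).erase y).biUnion (G.outerNeighborFinset v) := by
    intro c hc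
    simp only [secondNeighborFinset, Finset.mem_filter, Finset.mem_univ, true_and] at hc
    obtain ⟨hcv, hvc, u, hvu, huc⟩ := hc
    simp only [Finset.mem_biUnion, Finset.mem_erase, mem_neighborFinset, outerNeighborFinset,
      Finset.mem_filter, Finset.mem_univ, true_and]
    by_cases huy : u = y
    · subst huy
      have hxc : x ≠ c := fun e => hvc (e ▸ hx)
      have hzc : z ≠ c := fun e => hvc (e ▸ hz)
      -- Unless `x` or `z` also reaches `c`, the vertices `x`, `z`, `c` form a claw centred at `y`.
      rcases h.adj_or_adj_or_adj hxy.symm hyz huc hne hxc hzc with h | h | h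
      · exact absurd h hxz
      · exact ⟨x, ⟨hxy.ne, hx⟩, hcv, hvc, h⟩
      · exact ⟨z, ⟨hyz.ne', hz⟩, hcv, hvc, h⟩
    · exact ⟨u, ⟨huy, hvu⟩, hcv, hvc, huc⟩
  refine (Finset.card_le_card hsub).trans ?_
  refine (Finset.card_biUnion_le_card_mul _ _ (G.cliqueNum - 1) ?_).trans ?_
  · intro u hu
    have := h.card_outerNeighborFinset_lt (v := v) (u := u) (by simpa using Finset.mem_of_mem_erase hu)
    omega
  · rw [Finset.card_erase_of_mem (by simpa using hy), card_neighborFinset_eq_degree]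

open Classical in
/-- In a claw-free graph, the non-neighbours of `a` in the neighbourhood of `v` form a clique. -/
theorem ClawFree.card_nonneighbors_lt (h : G.ClawFree) {a : V} (ha : G.Adj v a) :
    ((G.neighborFinset v).filter fun x => x ≠ a ∧ ¬ G.Adj a x).card < G.cliqueNum := by
  refine card_lt_cliqueNum_of_forall_adj (v := v) ?_ (by simp +contextual)
  intro x hx y hy hxy
  simp only [Finset.coe_filter, mem_neighborFinset, Set.mem_ofPred_eq] at hx hy
  rcases h.adj_or_adj_or_adj ha hx.1 hy.1 hx.2.1.symm hy.2.1.symm hxy with h | h | h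
  · exact absurd h hx.2.2
  · exact absurd h hy.2.2
  · exact h

-- Let `a` be a common neighbour of `v` and `x`. Apart from neighbours of `x`, N(v) consists of
-- non-neighbours of `a`, at most ω-1 of them, and neighbours of `a` that miss `x`. The latter form
-- a clique, by the claw at `a` with leaf `x`; adding `a` and `v` to it shows that they number at
-- most ω-2.
open Classical in
theorem ClawFree.degree_add_two_le (h : G.ClawFree) {x : V}
    (hx : x ∈ G.secondNeighborFinset v) :
    G.degree v + 3 ≤ ((G.neighborFinset v).filter fun u => G.Adj u x).card + 2 * G.cliqueNum := by
  simp only [secondNeighborFinset, Finset.mem_filter, Finset.mem_univ, true_and] at hx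
  obtain ⟨hxv, hvx, a, hva, hax⟩ := hx
  have h1 := h.card_nonneighbors_lt hva
  have h2 : (insert a ((G.neighborFinset v).filter fun u => G.Adj a u ∧ ¬ G.Adj u x)).card
      < G.cliqueNum := by
    refine card_lt_cliqueNum_of_forall_adj (v := v) ?_ (by simp +contextual [hva])
    rw [Finset.coe_insert]
    refine IsClique.insert ?_ (by simp +contextual)
    intro y hy z hz hyz
    simp only [Finset.coe_filter, mem_neighborFinset, Set.mem_ofPred_eq] at hy hz
    have hyx : x ≠ y := fun e => hvx (e ▸ hy.1)
    have hzx : x ≠ z := fun e => hvx (e ▸ hz.1)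
    rcases h.adj_or_adj_or_adj hax hy.2.1 hz.2.1 hyx hzx hyz with h | h | h
    · exact absurd h.symm hy.2.2
    · exact absurd h.symm hz.2.2
    · exact h
  rw [Finset.card_insert_of_notMem (by simp)] at h2
  have h3 : (G.neighborFinset v).card ≤ ((G.neighborFinset v).filter fun u => G.Adj u x).card +
      (((G.neighborFinset v).filter fun x => x ≠ a ∧ ¬ G.Adj a x).card +
      ((G.neighborFinset v).filter fun u => G.Adj a u ∧ ¬ G.Adj u x).card) := by
    refine (Finset.card_le_card ?_).trans ((Finset.card_union_le _ _).trans
      (Nat.add_le_add_left (Finset.card_union_le _ _) _))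
    intro u hu
    simp only [Finset.mem_union, Finset.mem_filter, hu, true_and]
    by_cases hua : u = a
    · subst hua; exact Or.inl hax
    · tauto
  rw [card_neighborFinset_eq_degree] at h3
  omega

-- Each vertex of N(v) outside a largest clique of N(v) misses some member of it, and each member is
-- missed by at most ω-1 vertices. This crude bound is needed only for very large degrees.
open Classical in
theorem ClawFree.degree_le (h : G.ClawFree) (v : V) :
    G.degree v ≤ (G.cliqueNum - 1) * (G.cliqueNum - 1) + (G.cliqueNum - 1) := by
  obtain ⟨s, hs, hmax⟩ := Finset.exists_max_image
    ((G.neighborFinset v).powerset.filter fun s : Finset V => G.IsClique (s : Set V)) Finset.card ⟨∅, by simp⟩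
  simp only [Finset.mem_filter, Finset.mem_powerset] at hs hmax
  have hsv : ∀ x ∈ s, G.Adj v x := fun x hx => by simpa using hs.1 hx
  have hcard := card_lt_cliqueNum_of_forall_adj hs.2 hsv
  have hsub : G.neighborFinset v ⊆ (s.biUnion fun a =>
      (G.neighborFinset v).filter fun x => x ≠ a ∧ ¬ G.Adj a x) ∪ s := by
    intro x hx
    by_contra hn
    simp only [Finset.mem_union, Finset.mem_biUnion, Finset.mem_filter, hx, true_and, not_or,
      not_exists, not_and, not_not] at hn
    have := hmax (insert x s) ⟨Finset.insert_subset hx hs.1, by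
      rw [Finset.coe_insert]
      exact hs.2.insert fun b hb hne => (hn.1 b hb hne).symm⟩
    rw [Finset.card_insert_of_notMem hn.2] at this
    omega
  rw [← card_neighborFinset_eq_degree]
  refine (Finset.card_le_card hsub).trans ((Finset.card_union_le _ _).trans
    (Nat.add_le_add ?_ (by omega)))
  refine (Finset.card_biUnion_le_card_mul _ _ (G.cliqueNum - 1) ?_).trans
    (Nat.mul_le_mul_right _ (by omega))
  intro a ha
  have := h.card_nonneighbors_lt (hsv a ha)
  omega

-- Double count the edges between N(v) and the second neighbourhood.
open Classical in
theorem ClawFree.card_secondNeighborFinset_mul_le (h : G.ClawFree) (v : V) :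
    (G.secondNeighborFinset v).card * (G.degree v + 3 - 2 * G.cliqueNum) ≤
      G.degree v * (G.cliqueNum - 1) := by
  rw [← card_neighborFinset_eq_degree]
  refine Finset.card_mul_le_card_mul (fun x u => G.Adj u x) ?_ ?_
  · intro x hx
    have := h.degree_add_two_le hx
    rw [card_neighborFinset_eq_degree]
    exact Nat.sub_le_iff_le_add.2 this
  · intro u hu
    have := h.card_outerNeighborFinset_lt (by simpa using hu : G.Adj v u)
    refine (Finset.card_le_card ?_).trans (Nat.le_sub_one_of_lt this)
    intro x hx
    simp only [Finset.bipartiteBelow, secondNeighborFinset, outerNeighborFinset,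
      Finset.mem_filter, Finset.mem_univ, true_and] at hx ⊢
    exact ⟨hx.1.1, hx.1.2.1, hx.2⟩

open Classical in
theorem ClawFree.degree_square_lt (h : G.ClawFree) (hω : 5 ≤ G.cliqueNum)
    (hv : ¬ G.IsClusterNeighborhood v) :
    G.square.degree v < 2 * G.cliqueNum * (G.cliqueNum - 1) - 3 := by
  have h1 := degree_square_le G v
  have h2 := h.card_secondNeighborFinset_le hv
  have h3 := h.card_secondNeighborFinset_mul_le v
  have h4 := h.degree_le v
  generalize G.square.degree v = D at *
  generalize (G.secondNeighborFinset v).card = N at *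
  generalize G.degree v = n at *
  obtain ⟨t, ht⟩ : ∃ t, G.cliqueNum = t + 1 := ⟨G.cliqueNum - 1, by omega⟩
  rw [ht] at h2 h3 h4 hω ⊢
  simp only [Nat.add_sub_cancel] at h2 h3 h4 ⊢
  have ht4 : 4 ≤ t := by omega
  suffices n + N + 4 ≤ 2 * (t + 1) * t by omega
  -- For n ≤ 2t the path bound gives n + N ≤ 2t² + t, and 4 ≤ t is exactly what is needed. For
  -- larger n the double count takes over: N ≤ 3t²/2 while n ≤ 3t, and N ≤ 3t beyond, where n ≤ t² +
  -- t.
  rcases Nat.lt_or_ge (2 * t) n with hn | hn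
  · obtain ⟨m, rfl⟩ : ∃ m, n = m + 2 * t + 1 := ⟨n - 2 * t - 1, by omega⟩
    rw [show m + 2 * t + 1 + 3 - 2 * (t + 1) = m + 2 by omega] at h3
    rcases Nat.lt_or_ge m t with hm | hm
    · have : N * 2 ≤ N * (m + 2) := Nat.mul_le_mul_left _ (by omega)
      nlinarith
    · have : N ≤ 3 * t := by
        refine Nat.le_of_mul_le_mul_right (c := m + 2) (h3.trans ?_) (by omega)
        nlinarith
      nlinarith
  · have : (n - 1) * t ≤ (2 * t - 1) * t := Nat.mul_le_mul_right _ (by omega)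
    have e : (2 * t - 1) * t + t = 2 * t * t := by
      rw [← Nat.succ_mul]; congr 1; omega
    nlinarith

open Classical in
theorem degree_square_of_forall_not_adj (hv : ∀ u, ¬ G.Adj v u) : G.square.degree v = 0 := by
  rw [← card_neighborFinset_eq_degree, Finset.card_eq_zero, Finset.eq_empty_iff_forall_notMem]
  intro x hx
  rw [mem_neighborFinset] at hx
  rcases hx.2 with h | ⟨w, h, -⟩ <;> exact hv _ h

end Degree


/-! ### Greedy extension of colourings -/

open Classical in
/-- A colouring of the subgraph induced on `S` extends greedily to vertices of small degree. -/
theorem Colorable.of_induce {V : Type*} [Fintype V] {H : SimpleGraph V} {S : Set V} {k : ℕ}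
    (hk : 0 < k) (hS : (H.induce S).Colorable k) (hdeg : ∀ v ∉ S, H.degree v < k) :
    H.Colorable k := by
  obtain ⟨c₀⟩ := hS
  suffices key : ∀ T : Finset V, ∃ c : V → Fin k, ∀ u w, (u ∈ S ∨ u ∈ T) → (w ∈ S ∨ w ∈ T) →
      H.Adj u w → c u ≠ c w by
    obtain ⟨c, hc⟩ := key Finset.univ
    exact ⟨Coloring.mk c fun {u w} h => hc u w (by simp) (by simp) h⟩
  intro T
  induction T using Finset.induction_on with
  | empty =>
    -- The default colour is harmless: only vertices of `S ∪ T` are compared.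
    refine ⟨fun v => if hv : v ∈ S then c₀ ⟨v, hv⟩ else ⟨0, hk⟩, ?_⟩
    intro u w hu hw huw
    simp only [Finset.notMem_empty, or_false] at hu hw
    simp only [hu, hw, dif_pos]
    exact c₀.valid (v := ⟨u, hu⟩) (w := ⟨w, hw⟩) huw
  | insert a T ha ih =>
    obtain ⟨c, hc⟩ := ih
    by_cases haS : a ∈ S
    · refine ⟨c, fun u w hu hw huw => hc u w ?_ ?_ huw⟩
      · rcases hu with h | h
        · exact Or.inl h
        · rcases Finset.mem_insert.1 h with rfl | h
          · exact Or.inl haS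
          · exact Or.inr h
      · rcases hw with h | h
        · exact Or.inl h
        · rcases Finset.mem_insert.1 h with rfl | h
          · exact Or.inl haS
          · exact Or.inr h
    obtain ⟨i, hi⟩ : ∃ i, i ∉ (H.neighborFinset a).image c := by
      by_contra! hn
      have h1 : (Finset.univ : Finset (Fin k)) ⊆ (H.neighborFinset a).image c := fun i _ => hn i
      have h2 := (Finset.card_le_card h1).trans Finset.card_image_le
      rw [Finset.card_univ, Fintype.card_fin, card_neighborFinset_eq_degree] at h2
      exact absurd (hdeg a haS) (by omega)
    have hi' : ∀ w, H.Adj a w → c w ≠ i := fun w hw e =>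
      hi (Finset.mem_image.2 ⟨w, by simpa using hw, e⟩)
    refine ⟨Function.update c a i, fun u w hu hw huw => ?_⟩
    by_cases hua : u = a
    · subst hua
      rw [Function.update_self, Function.update_of_ne huw.ne']
      exact (hi' w huw).symm
    by_cases hwa : w = a
    · subst hwa
      rw [Function.update_self, Function.update_of_ne hua]
      exact hi' u huw.symm
    rw [Function.update_of_ne hua, Function.update_of_ne hwa]
    refine hc u w ?_ ?_ huw
    · simpa [hua] using hu
    · simpa [hwa] using hw

/-! ### Strong edge colouring under a degree bound -/

/-- An injective homomorphism is also a homomorphism between the squares. -/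
def Copy.square {V W : Type*} {G : SimpleGraph V} {H : SimpleGraph W} (f : Copy G H) :
    G.square →g H.square where
  toFun := f
  map_rel' h := ⟨fun e => h.1 (f.injective e), h.2.imp f.toHom.map_adj
    fun ⟨w, h1, h2⟩ => ⟨f w, f.toHom.map_adj h1, f.toHom.map_adj h2⟩⟩

-- The supremum ranges over maximum degree exactly `d`; a disjoint star raises a smaller maximum
-- degree to `d`.
open Classical in
theorem maxDegree_sum_completeBipartiteGraph {W : Type*} [Fintype W] (F : SimpleGraph W) {d : ℕ}
    (hd : 1 ≤ d) (hF : ∀ w, F.degree w ≤ d) :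
    (F ⊕g completeBipartiteGraph (Fin 1) (Fin d)).maxDegree = d := by
  have hcenter : (F ⊕g completeBipartiteGraph (Fin 1) (Fin d)).degree (.inr (.inl 0)) = d := by
    rw [← card_neighborFinset_eq_degree]
    trans (Finset.univ.image fun j : Fin d => (.inr (.inr j) : W ⊕ (Fin 1 ⊕ Fin d))).card
    · congr 1
      ext (a | a | a) <;> simp
    · rw [Finset.card_image_of_injective _ (fun _ _ h => by simpa using h)]
      simp
  refine le_antisymm (maxDegree_le_of_forall_degree_le _ _ ?_) (hcenter.ge.trans ?_)
  swap
  · refine le_trans (le_of_eq ?_) (degree_le_maxDegree _ (.inr (.inl 0)))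
    convert hcenter.symm
  rintro (w | w | w)
  · rw [← card_neighborFinset_eq_degree]
    refine le_trans (Finset.card_le_card (t := (F.neighborFinset w).image Sum.inl) ?_)
      (Finset.card_image_le.trans ((card_neighborFinset_eq_degree _ _).trans_le (hF w)))
    rintro (a | a) <;> simp
  · rw [Subsingleton.elim w 0]
    apply le_of_eq
    convert hcenter
  · rw [← card_neighborFinset_eq_degree]
    refine le_trans (Finset.card_le_card (t := {.inr (.inl 0)}) ?_) (by simpa using hd)
    rintro (a | a | a) <;> simp
    exact Subsingleton.elim _ _

open Classical in
/-- The bound `strongChromaticSup d` also applies to graphs of maximum degree less than `d`. -/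
theorem colorable_square_lineGraph {W : Type*} [Fintype W] (F : SimpleGraph W) {d k : ℕ}
    (hd : 1 ≤ d) (hF : ∀ w, F.degree w ≤ d) (hk : strongChromaticSup d ≤ k) :
    F.lineGraph.square.Colorable k := by
  set F' := F ⊕g completeBipartiteGraph (Fin 1) (Fin d)
  let e := Fintype.equivFin (W ⊕ (Fin 1 ⊕ Fin d))
  let φ : F' ≃g F'.map e.toEmbedding := Iso.map e F'
  have hmax : (F'.map e.toEmbedding).maxDegree = d := by
    exact φ.maxDegree_eq.symm.trans (maxDegree_sum_completeBipartiteGraph F hd hF)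
  have hcol : (F'.map e.toEmbedding).lineGraph.square.Colorable k := by
    rw [← chromaticNumber_le_iff_colorable]
    refine le_trans ?_ hk
    exact le_iSup_of_le _ (le_iSup_of_le (F'.map e.toEmbedding) (le_iSup_of_le (by convert hmax) le_rfl))
  let ψ : Copy F (F'.map e.toEmbedding) :=
    φ.toCopy.comp (Embedding.sumInl : F ↪g F').toCopy
  exact hcol.of_hom ψ.lineGraph.square

end SimpleGraph

/-! ### Cluster cliques -/

namespace SimpleGraph

variable {V : Type*} [Fintype V] {G : SimpleGraph V}

open Classical in
/-- The common closed neighbourhood of `u` and `w`. -/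
noncomputable def commonClosedNeighbors (G : SimpleGraph V) (u w : V) : Finset V :=
  {x | (x = u ∨ G.Adj x u) ∧ (x = w ∨ G.Adj x w)}

theorem mem_commonClosedNeighbors {u w x : V} :
    x ∈ G.commonClosedNeighbors u w ↔ (x = u ∨ G.Adj x u) ∧ (x = w ∨ G.Adj x w) := by
  simp [commonClosedNeighbors]

theorem commonClosedNeighbors_comm (u w : V) :
    G.commonClosedNeighbors u w = G.commonClosedNeighbors w u := by
  ext x
  simp [mem_commonClosedNeighbors, and_comm]

theorem left_mem_commonClosedNeighbors {u w : V} (h : G.Adj u w) :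
    u ∈ G.commonClosedNeighbors u w := by
  simp [mem_commonClosedNeighbors, h]

theorem right_mem_commonClosedNeighbors {u w : V} (h : G.Adj u w) :
    w ∈ G.commonClosedNeighbors u w := by
  simp [mem_commonClosedNeighbors, h.symm]

/-- The cliques spanned by an edge at a vertex whose neighbourhood is a disjoint union of
cliques. -/
def clusterCliques (G : SimpleGraph V) : Set (Finset V) :=
  {K | ∃ u w, G.IsClusterNeighborhood u ∧ G.Adj u w ∧ K = G.commonClosedNeighbors u w}

theorem IsClusterNeighborhood.mem_clusterCliques {u w : V} (hu : G.IsClusterNeighborhood u)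
    (h : G.Adj u w) : G.commonClosedNeighbors u w ∈ G.clusterCliques :=
  ⟨u, w, hu, h, rfl⟩

theorem isClique_of_mem_clusterCliques {K : Finset V} (hK : K ∈ G.clusterCliques) :
    G.IsClique (K : Set V) := by
  obtain ⟨u, w, hu, huw, rfl⟩ := hK
  intro x hx y hy hxy
  rw [Finset.mem_coe, mem_commonClosedNeighbors] at hx hy
  obtain ⟨rfl | hx, hx'⟩ := hx
  · obtain ⟨rfl | hy, -⟩ := hy
    · exact absurd rfl hxy
    · exact hy.symm
  obtain ⟨rfl | hy, hy'⟩ := hy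
  · exact hx
  rcases hx' with rfl | hx'
  · exact (hy'.resolve_left hxy.symm).symm
  rcases hy' with rfl | hy'
  · exact hx'
  exact hu hx.symm huw hy.symm hx' hy'.symm hxy

/-- Among neighbours of a clustered `u`, being equal or adjacent is transitive. So a common closed
neighbour of `u` and `w` is linked through `w` to all of `K`, including the two vertices that define
`K`. Thus two vertices of `K`, one of them clustered, determine `K`. -/
theorem eq_commonClosedNeighbors {K : Finset V} (hK : K ∈ G.clusterCliques) {u w : V}
    (hu : u ∈ K) (hw : w ∈ K) (huw : u ≠ w) (hcl : G.IsClusterNeighborhood u) :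
    K = G.commonClosedNeighbors u w := by
  have hclique := isClique_of_mem_clusterCliques hK
  have hR : ∀ {x y}, x ∈ K → y ∈ K → x = y ∨ G.Adj x y := fun {x y} hx hy =>
    or_iff_not_imp_left.2 fun h => hclique hx hy h
  have huw' : G.Adj u w := hclique hu hw huw
  refine Finset.Subset.antisymm (fun x hx => mem_commonClosedNeighbors.2 ⟨hR hx hu, hR hx hw⟩) ?_
  intro y hy
  -- Any two closed neighbours of `u` joined through a third one are adjacent or equal.
  have htrans : ∀ {v a b c : V}, G.IsClusterNeighborhood v → G.Adj v a → G.Adj v b → G.Adj v c →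
      (a = b ∨ G.Adj a b) → (b = c ∨ G.Adj b c) → (a = c ∨ G.Adj a c) := by
    intro v a b c hv ha hb hc hab hbc
    rcases hab with rfl | hab
    · exact hbc
    rcases hbc with rfl | hbc
    · exact Or.inr hab
    exact or_iff_not_imp_left.2 (hv ha hb hc hab hbc)
  rw [mem_commonClosedNeighbors] at hy
  rcases hy with ⟨rfl | hyu, hyw⟩
  · exact hu
  have key : ∀ z ∈ K, y = z ∨ G.Adj y z := by
    intro z hz
    by_cases hzu : z = u
    · subst hzu; exact Or.inr hyu
    exact htrans hcl hyu.symm huw' (hclique hu hz (Ne.symm hzu)) hyw (hR hw hz)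
  obtain ⟨u', w', hu', huw₂, rfl⟩ := hK
  exact mem_commonClosedNeighbors.2 ⟨key _ (left_mem_commonClosedNeighbors huw₂),
    key _ (right_mem_commonClosedNeighbors huw₂)⟩

theorem clusterCliques_eq {K K' : Finset V} (hK : K ∈ G.clusterCliques)
    (hK' : K' ∈ G.clusterCliques) {u w : V} (hu : u ∈ K) (hw : w ∈ K) (hu' : u ∈ K')
    (hw' : w ∈ K') (huw : u ≠ w) (hcl : G.IsClusterNeighborhood u) : K = K' :=
  (eq_commonClosedNeighbors hK hu hw huw hcl).trans
    (eq_commonClosedNeighbors hK' hu' hw' huw hcl).symm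

/-- In a claw-free graph, every vertex lies in at most two of the cluster cliques. -/
theorem ClawFree.eq_or_eq_or_eq (h : G.ClawFree) {w : V} {K₁ K₂ K₃ : Finset V}
    (h₁ : K₁ ∈ G.clusterCliques) (h₂ : K₂ ∈ G.clusterCliques) (h₃ : K₃ ∈ G.clusterCliques)
    (hw₁ : w ∈ K₁) (hw₂ : w ∈ K₂) (hw₃ : w ∈ K₃) : K₁ = K₂ ∨ K₁ = K₃ ∨ K₂ = K₃ := by
  have hex : ∀ K ∈ G.clusterCliques, w ∈ K →
      ∃ y ∈ K, y ≠ w ∧ (G.IsClusterNeighborhood y ∨ G.IsClusterNeighborhood w) := by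
    rintro _ ⟨u, v, hu, huv, rfl⟩ hw
    by_cases huw : u = w
    · exact ⟨v, right_mem_commonClosedNeighbors huv, huw ▸ huv.ne', Or.inr (huw ▸ hu)⟩
    · exact ⟨u, left_mem_commonClosedNeighbors huv, huw, Or.inl hu⟩
  -- If `y` and `y'` are equal or adjacent, then `y'` lies in `K`, so `K` and `K'` share the
  -- determining pair `y'`, `w`. Three distinct cliques would therefore give a claw at `w`.
  have hkey : ∀ {K K' : Finset V} {y y' : V}, K ∈ G.clusterCliques → K' ∈ G.clusterCliques →
      w ∈ K → w ∈ K' → y ∈ K → y' ∈ K' → y ≠ w → y' ≠ w →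
      (G.IsClusterNeighborhood y ∨ G.IsClusterNeighborhood w) →
      (G.IsClusterNeighborhood y' ∨ G.IsClusterNeighborhood w) →
      (y = y' ∨ G.Adj y y') → K = K' := by
    intro K K' y y' hK hK' hw hw' hy hy' hyw hyw' hc hc' hR
    have hKeq : K = G.commonClosedNeighbors y w := by
      rcases hc with hc | hc
      · exact eq_commonClosedNeighbors hK hy hw hyw hc
      · rw [commonClosedNeighbors_comm]
        exact eq_commonClosedNeighbors hK hw hy hyw.symm hc
    have hy'K : y' ∈ K := by
      rw [hKeq, mem_commonClosedNeighbors]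
      exact ⟨hR.imp Eq.symm Adj.symm, Or.inr (isClique_of_mem_clusterCliques hK' hy' hw' hyw')⟩
    rcases hc' with hc' | hc'
    · exact clusterCliques_eq hK hK' hy'K hw hy' hw' hyw' hc'
    · exact clusterCliques_eq hK hK' hw hy'K hw' hy' hyw'.symm hc'
  obtain ⟨y₁, hy₁, hn₁, hc₁⟩ := hex K₁ h₁ hw₁
  obtain ⟨y₂, hy₂, hn₂, hc₂⟩ := hex K₂ h₂ hw₂
  obtain ⟨y₃, hy₃, hn₃, hc₃⟩ := hex K₃ h₃ hw₃
  have hadj : ∀ {K : Finset V} {y : V}, K ∈ G.clusterCliques → w ∈ K → y ∈ K → y ≠ w → G.Adj w y :=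
    fun hK hw hy hn => isClique_of_mem_clusterCliques hK hw hy hn.symm
  have k₁₂ := hkey h₁ h₂ hw₁ hw₂ hy₁ hy₂ hn₁ hn₂ hc₁ hc₂
  have k₁₃ := hkey h₁ h₃ hw₁ hw₃ hy₁ hy₃ hn₁ hn₃ hc₁ hc₃
  have k₂₃ := hkey h₂ h₃ hw₂ hw₃ hy₂ hy₃ hn₂ hn₃ hc₂ hc₃
  by_contra! hne
  rcases h.adj_or_adj_or_adj (hadj h₁ hw₁ hy₁ hn₁) (hadj h₂ hw₂ hy₂ hn₂) (hadj h₃ hw₃ hy₃ hn₃)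
    (fun e => hne.1 (k₁₂ (Or.inl e))) (fun e => hne.2.1 (k₁₃ (Or.inl e)))
    (fun e => hne.2.2 (k₂₃ (Or.inl e))) with e | e | e
  · exact hne.1 (k₁₂ (Or.inr e))
  · exact hne.2.1 (k₁₃ (Or.inr e))
  · exact hne.2.2 (k₂₃ (Or.inr e))

/-! ### The root graph and its edges -/

/-- Adjacency between the cluster clique `K` and a clique or a vertex: another cluster clique
meeting `K`, or a vertex of `K` that lies in no other cluster clique. -/
def rootAdj (G : SimpleGraph V) (K : Finset V) : Finset V ⊕ V → Prop
  | .inl K' => K ∈ G.clusterCliques ∧ K' ∈ G.clusterCliques ∧ K ≠ K' ∧ ∃ w, w ∈ K ∧ w ∈ K'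
  | .inr v => K ∈ G.clusterCliques ∧ v ∈ K ∧ ∀ K' ∈ G.clusterCliques, v ∈ K' → K' = K

/-- The graph on the cluster cliques in which cliques that meet are adjacent, with a pendant edge
added for each vertex in just one of the cliques. -/
def rootGraph (G : SimpleGraph V) : SimpleGraph (Finset V ⊕ V) where
  Adj
    | .inl K, z => G.rootAdj K z
    | .inr v, .inl K => G.rootAdj K (.inr v)
    | .inr _, .inr _ => False
  symm := ⟨by
    rintro (K | v) (K' | v')
    · rintro ⟨h, h', hne, w, hw, hw'⟩
      exact ⟨h', h, hne.symm, w, hw', hw⟩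
    · exact id
    · exact id
    · exact id⟩
  loopless := ⟨by
    rintro (K | v)
    · exact fun h => h.2.2.1 rfl
    · exact id⟩

open Classical in
theorem ClawFree.degree_rootGraph_le (h : G.ClawFree) (hω : 1 ≤ G.cliqueNum)
    (z : Finset V ⊕ V) : G.rootGraph.degree z ≤ G.cliqueNum := by
  rw [← card_neighborFinset_eq_degree]
  rcases z with K | v
  · by_cases hK : K ∈ G.clusterCliques
    swap
    · convert Nat.zero_le _
      rw [Finset.card_eq_zero, Finset.eq_empty_iff_forall_notMem]
      rintro (K' | v) hz <;> rw [mem_neighborFinset] at hz <;> exact hK hz.1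
    refine le_trans ?_ (isClique_of_mem_clusterCliques hK).card_le_cliqueNum
    -- Charge a clique meeting `K` to a shared vertex, and a pendant neighbour to itself. No vertex
    -- of `K` is charged twice, as it lies in at most one other cluster clique, and in none if it is
    -- pendant.
    refine Finset.card_le_card_of_forall_subsingleton
      (fun z w => Sum.elim (fun K' => w ∈ K') (fun v => w = v) z) ?_ ?_
    · rintro (K' | v) hz <;> rw [mem_neighborFinset] at hz
      · obtain ⟨-, -, -, w, hw, hw'⟩ := hz
        exact ⟨w, hw, hw'⟩
      · exact ⟨v, hz.2.1, rfl⟩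
    · rintro w hw (K₁ | v₁) ⟨hz₁, hr₁⟩ (K₂ | v₂) ⟨hz₂, hr₂⟩ <;>
        rw [mem_neighborFinset] at hz₁ hz₂ <;> simp only [Sum.elim_inl, Sum.elim_inr] at hr₁ hr₂
      · rcases h.eq_or_eq_or_eq hK hz₁.2.1 hz₂.2.1 hw hr₁ hr₂ with e | e | e
        · exact absurd e hz₁.2.2.1
        · exact absurd e hz₂.2.2.1
        · rw [e]
      · subst hr₂
        exact absurd (hz₂.2.2 K₁ hz₁.2.1 hr₁).symm hz₁.2.2.1
      · subst hr₁
        exact absurd (hz₁.2.2 K₂ hz₂.2.1 hr₂).symm hz₂.2.2.1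
      · rw [← hr₁, ← hr₂]
  · refine le_trans (Finset.card_le_one.2 ?_) hω
    rintro (K₁ | v₁) hz₁ (K₂ | v₂) hz₂ <;> rw [mem_neighborFinset] at hz₁ hz₂
    · rw [hz₂.2.2 K₁ hz₁.1 hz₁.2.1]
    · exact hz₂.elim
    · exact hz₁.elim
    · exact hz₁.elim

/-- The edge `e` of the root graph represents the vertex `v`. -/
structure IsRootEdge (G : SimpleGraph V) (v : V) (e : Sym2 (Finset V ⊕ V)) : Prop where
  inl_mem : ∀ K ∈ G.clusterCliques, v ∈ K → .inl K ∈ e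
  mem_of_inl_mem : ∀ K, .inl K ∈ e → K ∈ G.clusterCliques ∧ v ∈ K
  eq_of_inr_mem : ∀ w, .inr w ∈ e → w = v

theorem ClawFree.exists_isRootEdge (h : G.ClawFree) {v u : V} (hv : G.IsClusterNeighborhood v)
    (hu : G.Adj v u) : ∃ e : G.rootGraph.edgeSet, G.IsRootEdge v e := by
  have hK := hv.mem_clusterCliques hu
  have hvK := left_mem_commonClosedNeighbors hu
  set K := G.commonClosedNeighbors v u
  by_cases hex : ∃ K' ∈ G.clusterCliques, v ∈ K' ∧ K ≠ K'
  · obtain ⟨K', hK', hvK', hne⟩ := hex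
    have hadj : G.rootGraph.Adj (.inl K) (.inl K') := ⟨hK, hK', hne, v, hvK, hvK'⟩
    refine ⟨⟨s(.inl K, .inl K'), hadj⟩, ?_, ?_, ?_⟩
    · intro L hL hvL
      rcases h.eq_or_eq_or_eq hK hK' hL hvK hvK' hvL with e | e | e
      · exact absurd e hne
      · simp [e]
      · simp [e]
    · intro L hL
      rcases (by simpa using hL : L = K ∨ L = K') with rfl | rfl
      · exact ⟨hK, hvK⟩
      · exact ⟨hK', hvK'⟩
    · intro w hw
      simp at hw
  · push Not at hex
    have hadj : G.rootGraph.Adj (.inl K) (.inr v) :=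
      ⟨hK, hvK, fun K' hK' hv' => (hex K' hK' hv').symm⟩
    refine ⟨⟨s(.inl K, .inr v), hadj⟩, ?_, ?_, ?_⟩
    · intro L hL hvL
      simp [hex L hL hvL]
    · intro L hL
      obtain rfl : L = K := by simpa using hL
      exact ⟨hK, hvK⟩
    · intro w hw
      simpa using hw

/-- Vertices with a common edge either lie together in two distinct cluster cliques, which a
clustered vertex forbids, or equal the same pendant end. -/
theorem IsRootEdge.ne {u v : V} {e f : G.rootGraph.edgeSet} (he : G.IsRootEdge u e)
    (hf : G.IsRootEdge v f) (huv : u ≠ v) (hu : G.IsClusterNeighborhood u) : e ≠ f := by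
  rintro rfl
  obtain ⟨e, hadj⟩ := e
  induction e with | h x y => ?_
  rw [mem_edgeSet] at hadj
  rcases x with K | w
  · rcases y with K' | w
    · have h₁ := he.mem_of_inl_mem K (by simp)
      have h₂ := he.mem_of_inl_mem K' (by simp)
      have h₃ := hf.mem_of_inl_mem K (by simp)
      have h₄ := hf.mem_of_inl_mem K' (by simp)
      exact hadj.2.2.1 (clusterCliques_eq h₁.1 h₂.1 h₁.2 h₃.2 h₂.2 h₄.2 huv hu)
    · exact huv ((he.eq_of_inr_mem w (by simp)).symm.trans (hf.eq_of_inr_mem w (by simp)))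
  · exact huv ((he.eq_of_inr_mem w (by simp)).symm.trans (hf.eq_of_inr_mem w (by simp)))

theorem IsRootEdge.lineGraph_adj {u v : V} {e f : G.rootGraph.edgeSet} (he : G.IsRootEdge u e)
    (hf : G.IsRootEdge v f) (hef : e ≠ f) {K : Finset V} (hK : K ∈ G.clusterCliques)
    (huK : u ∈ K) (hvK : v ∈ K) : G.rootGraph.lineGraph.Adj e f :=
  ⟨hef, .inl K, he.inl_mem K hK huK, hf.inl_mem K hK hvK⟩

theorem IsRootEdge.lineGraph_square_adj {u v : V} {e f : G.rootGraph.edgeSet}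
    (he : G.IsRootEdge u e) (hf : G.IsRootEdge v f) (hu : G.IsClusterNeighborhood u)
    (hv : G.IsClusterNeighborhood v) (huv : G.square.Adj u v) :
    G.rootGraph.lineGraph.square.Adj e f := by
  obtain ⟨hne, huv⟩ := huv
  have hef := he.ne hf hne hu
  refine ⟨hef, ?_⟩
  rcases huv with huv | ⟨w, huw, hwv⟩
  · exact Or.inl (he.lineGraph_adj hf hef (hu.mem_clusterCliques huv)
      (left_mem_commonClosedNeighbors huv) (right_mem_commonClosedNeighbors huv))
  have hK₁ := hu.mem_clusterCliques huw
  have hK₂ := hv.mem_clusterCliques hwv.symm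
  have huK₁ := left_mem_commonClosedNeighbors huw
  have hwK₁ := right_mem_commonClosedNeighbors huw
  have hvK₂ := left_mem_commonClosedNeighbors hwv.symm
  have hwK₂ := right_mem_commonClosedNeighbors hwv.symm
  generalize G.commonClosedNeighbors u w = K₁ at *
  generalize G.commonClosedNeighbors v w = K₂ at *
  by_cases hK : K₁ = K₂
  · subst hK
    exact Or.inl (he.lineGraph_adj hf hef hK₁ huK₁ hvK₂)
  -- The cliques meet in `w`, which makes them adjacent whether or not `w` is clustered. If the
  -- joining edge is `e` or `f` itself, then `e` and `f` already share an end.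
  have hadj : G.rootGraph.Adj (.inl K₁) (.inl K₂) := ⟨hK₁, hK₂, hK, w, hwK₁, hwK₂⟩
  let m : G.rootGraph.edgeSet := ⟨s(.inl K₁, .inl K₂), hadj⟩
  have hem : ∃ z, z ∈ e.1 ∧ z ∈ m.1 :=
    ⟨.inl K₁, he.inl_mem K₁ hK₁ huK₁, Sym2.mem_mk_left _ _⟩
  have hmf : ∃ z, z ∈ m.1 ∧ z ∈ f.1 :=
    ⟨.inl K₂, Sym2.mem_mk_right _ _, hf.inl_mem K₂ hK₂ hvK₂⟩
  by_cases h₁ : e = m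
  · rw [← h₁] at hmf
    exact Or.inl ⟨hef, hmf⟩
  by_cases h₂ : m = f
  · rw [h₂] at hem
    exact Or.inl ⟨hef, hem⟩
  exact Or.inr ⟨m, ⟨h₁, hem⟩, ⟨h₂, hmf⟩⟩

/-- The vertices of a claw-free graph whose neighbourhoods are disjoint unions of cliques can be
coloured like the edges of a graph of maximum degree at most the clique number. -/
theorem ClawFree.colorable_induce_square (h : G.ClawFree) (hω : 1 ≤ G.cliqueNum) {k : ℕ}
    (hk : strongChromaticSup G.cliqueNum ≤ k) :
    (G.square.induce {v | G.IsClusterNeighborhood v ∧ ∃ u, G.Adj v u}).Colorable k := by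
  have hex : ∀ v : {v | G.IsClusterNeighborhood v ∧ ∃ u, G.Adj v u},
      ∃ e : G.rootGraph.edgeSet, G.IsRootEdge v.1 e := by
    rintro ⟨v, hv, u, hu⟩
    exact h.exists_isRootEdge hv hu
  choose φ hφ using hex
  have := colorable_square_lineGraph G.rootGraph hω (h.degree_rootGraph_le hω) hk
  exact this.of_hom ⟨φ, fun {u v} huv =>
    (hφ u).lineGraph_square_adj (hφ v) u.2.1 v.2.1 huv⟩

end SimpleGraph

/-! ### The main bound -/

theorem theorem2 (ω : ℕ) (hω : 5 ≤ ω) {V : Type*} [Fintype V] (G : SimpleGraph V)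
    (hclaw : G.ClawFree) (hG : G.cliqueNum = ω) :
    G.square.chromaticNumber ≤
      max (strongChromaticSup ω) ((2 * ω * (ω - 1) - 3 : ℕ) : ℕ∞) := by
  classical
  subst hG
  -- Keeps the truncated difference positive, so that there is a colour for isolated vertices.
  have h40 : 2 * 5 * 4 ≤ 2 * G.cliqueNum * (G.cliqueNum - 1) :=
    Nat.mul_le_mul (by omega) (by omega)
  generalize hmax : max (strongChromaticSup G.cliqueNum)
    ((2 * G.cliqueNum * (G.cliqueNum - 1) - 3 : ℕ) : ℕ∞) = M
  have h₁ := (le_max_left _ _).trans_eq hmax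
  have h₂ := (le_max_right _ _).trans_eq hmax
  induction M using ENat.recTopCoe with
  | top => exact le_top
  | coe k =>
    rw [SimpleGraph.chromaticNumber_le_iff_colorable]
    have hk : 2 * G.cliqueNum * (G.cliqueNum - 1) - 3 ≤ k := by exact_mod_cast h₂
    refine SimpleGraph.Colorable.of_induce (by omega)
      (hclaw.colorable_induce_square (by omega) h₁) fun v hv => ?_
    by_cases hcl : G.IsClusterNeighborhood v
    · have : ∀ u, ¬ G.Adj v u := fun u hu => hv ⟨hcl, u, hu⟩
      have := SimpleGraph.degree_square_of_forall_not_adj this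
      convert (by omega : 0 < k)
    · refine lt_of_lt_of_le ?_ hk
      convert hclaw.degree_square_lt hω hcl
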